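/- Let $0<\gamma<1$. Let $\Lambda_\gamma$ be the space of $2\pi$-periodic (real- or complex-valued) functions $\phi$ on $\mathbb{R}$ that are Hölder continuous with exponent $\gamma$, with the semi-norm $\|\phi\|_{\Lambda_\gamma}=\sup_{s\neq t}|\phi(s)-\phi(t)|/|s-t|^{\gamma}$. Integrals over $[-\pi,\pi]$ are principal values with respect to $t=0$ and $t=\pm\pi$: $$\int_{-\pi}^{\pi}f(t)\,dt:=\lim_{\varepsilon\to0+}\Big(\int_{-\pi+\varepsilon}^{-\varepsilon}f(t)\,dt+\int_{\varepsilon}^{\pi-\varepsilon}f(t)\,dt\Big).$$ Put $$\mathcal{K}_1\phi(\alpha)=\frac1\pi\int_{-\pi}^{\pi}\frac{\phi(\alpha-t)}{\sin t}\,dt,\qquad \mathcal{H}\phi(\alpha)=\frac1{2\pi}\int_{-\pi}^{\pi}\frac{\phi(\alpha-t)}{\tan(t/2)}\,dt .$$ (Substituting $\theta=\alpha-t$, the first integral is, up to sign, the principal value of $\frac1\pi\int_{-\pi}^{\pi}\frac{\phi(\theta)}{\sin(\theta-\alpha)}\,d\theta$.) Then $\mathcal{H}$ is a well-defined bounded operator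 from $\Lambda_\gamma$ to $\Lambda_\gamma$. Let $\|\mathcal{H}\|_{\Lambda_\gamma\to\Lambda_\gamma}<\infty$ be its norm with respect to the semi-norm, that is, the least $M\ge 0$ such that $\|\mathcal{H}\phi\|_{\Lambda_\gamma}\le M\|\phi\|_{\Lambda_\gamma}$ for all $\phi\in\Lambda_\gamma$. For every even $\phi\in\Lambda_\gamma$ and every $\alpha\in\mathbb{R}$ the principal value defining $\mathcal{K}_1\phi(\alpha)$ exists, and $$|\mathcal{K}_1\phi(\alpha)|\le c_\gamma\|\phi\|_{\Lambda_\gamma},\qquad c_\gamma=\gamma^{-1}\pi^{\gamma-1}+\|\mathcal{H}\|_{\Lambda_\gamma\to\Lambda_\gamma}(2\pi)^{\gamma}.$$ -/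

import Mathlib

open scoped NNReal ENNReal Topology

/-- The truncated integral of `f` over `[-π, π]`, with `ε`-neighbourhoods of the singular points
`0` and `±π` removed. -/
noncomputable def truncIntegral {𝕜 : Type*} [RCLike 𝕜] (f : ℝ → 𝕜) (ε : ℝ) : 𝕜 :=
  (∫ t in (-Real.pi + ε)..(-ε), f t) + ∫ t in ε..(Real.pi - ε), f t

/-- The principal value of `∫_{-π}^{π} f` exists and equals `I`: all truncated integrals
converge absolutely, and they tend to `I` as `ε → 0+`. -/
def HasPrincipalValue {𝕜 : Type*} [RCLike 𝕜] (f : ℝ → 𝕜) (I : 𝕜) : Prop :=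
  (∀ ε ∈ Set.Ioo (0 : ℝ) (Real.pi / 2),
    IntervalIntegrable f MeasureTheory.volume (-Real.pi + ε) (-ε) ∧
    IntervalIntegrable f MeasureTheory.volume ε (Real.pi - ε)) ∧
  Filter.Tendsto (truncIntegral f) (𝓝[>] (0 : ℝ)) (𝓝 I)

/-- The principal value of `∫_{-π}^{π} f` (meaningful when `HasPrincipalValue f I` for some `I`,
and then equal to `I`). -/
noncomputable def principalValue {𝕜 : Type*} [RCLike 𝕜] (f : ℝ → 𝕜) : 𝕜 :=
  Filter.limUnder (𝓝[>] (0 : ℝ)) (truncIntegral f)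

theorem HasPrincipalValue.principalValue_eq {𝕜 : Type*} [RCLike 𝕜] {f : ℝ → 𝕜} {I : 𝕜}
    (h : HasPrincipalValue f I) : principalValue f = I :=
  h.2.limUnder_eq

/-- The integrand `t ↦ φ(α - t) / sin t` of the operator `𝒦₁`. -/
noncomputable def sinIntegrand {𝕜 : Type*} [RCLike 𝕜] (φ : ℝ → 𝕜) (α t : ℝ) : 𝕜 :=
  φ (α - t) / ((Real.sin t : ℝ) : 𝕜)

/-- `𝒦₁ φ(α) = (1/π) p.v. ∫_{-π}^{π} φ(α - t) / sin t dt`. -/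
noncomputable def opK1 {𝕜 : Type*} [RCLike 𝕜] (φ : ℝ → 𝕜) (α : ℝ) : 𝕜 :=
  ((1 / Real.pi : ℝ) : 𝕜) * principalValue (sinIntegrand φ α)

/-- The integrand `t ↦ φ(α - t) / tan (t / 2)` of the periodic Hilbert transform. -/
noncomputable def tanIntegrand {𝕜 : Type*} [RCLike 𝕜] (φ : ℝ → 𝕜) (α t : ℝ) : 𝕜 :=
  φ (α - t) / ((Real.tan (t / 2) : ℝ) : 𝕜)

/-- The Hilbert transform `ℋ φ(α) = (1/2π) p.v. ∫_{-π}^{π} φ(α - t) / tan (t / 2) dt`. -/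
noncomputable def hilbertTransform {𝕜 : Type*} [RCLike 𝕜] (φ : ℝ → 𝕜) (α : ℝ) : 𝕜 :=
  ((1 / (2 * Real.pi) : ℝ) : 𝕜) * principalValue (tanIntegrand φ α)

/-- The space `Λ_γ` of `2π`-periodic functions on `ℝ` that are Hölder continuous with
exponent `γ`. Its semi-norm is Mathlib's `eHolderNorm γ` (or `nnHolderNorm γ`), the least
constant `C` with `|φ(s) - φ(t)| ≤ C |s - t| ^ γ` for all `s`, `t`. -/
def holderPeriodic (𝕜 : Type*) [RCLike 𝕜] (γ : ℝ≥0) : Set (ℝ → 𝕜) :=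
  {φ | Function.Periodic φ (2 * Real.pi) ∧ MemHolder γ φ}

/-- The operator norm `‖ℋ‖_{Λ_γ → Λ_γ}` with respect to the Hölder semi-norm, with values in
`[0, ∞]`. -/
noncomputable def hilbertNorm (𝕜 : Type*) [RCLike 𝕜] (γ : ℝ≥0) : ℝ≥0∞ :=
  sInf {M : ℝ≥0∞ | ∀ φ ∈ holderPeriodic 𝕜 γ,
    eHolderNorm γ (hilbertTransform φ) ≤ M * eHolderNorm γ φ}

/-- The constant `c_γ = γ⁻¹ π^{γ-1} + ‖ℋ‖_{Λ_γ → Λ_γ} (2π)^γ`. -/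
noncomputable def constC (𝕜 : Type*) [RCLike 𝕜] (γ : ℝ≥0) : ℝ :=
  (γ : ℝ)⁻¹ * Real.pi ^ ((γ : ℝ) - 1) + (hilbertNorm 𝕜 γ).toReal * (2 * Real.pi) ^ (γ : ℝ)

/-! Since `1 / sin t` is half of `cot (t/2) + tan (t/2)`, and `tan (t/2) = -cot ((t ± π)/2)`, the
cosecant kernel is half the difference of the Hilbert kernel and its translate by `π`. Hence `𝒦₁
φ(α) = ℋφ(α) - ℋφ(α - π)` (`opK1_eq_hilbertTransform_sub`), which is at most `‖ℋ‖ ‖φ‖ π^γ`; the term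
`γ⁻¹ π^(γ-1)` and the passage from `π^γ` to `(2π)^γ` are slack.

The analytic work is Privalov's theorem, that `ℋ` is bounded on `Λ_γ`. With `G_x` the primitive of
`φ(x - t) - φ(x + t)`, integration by parts moves the derivative onto the cotangent and gives a
kernel of size `t⁻²`. The difference `G_x - G_y` is `O(t^(γ+1))` trivially, and `O(|x - y| t^γ)`
because `G_x(t)` is differentiable in `x`. The first bound is used for `t ≤ |x - y|`, the second
beyond; both parts contribute `O(|x - y|^γ)`, uniformly in the truncation
(`norm_truncIntegral_sub_le`). -/

/-! ### The cotangent kernel and its size -/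

/-- The kernel `cot (t / 2)` of the periodic Hilbert transform. -/
noncomputable def cotHalf (t : ℝ) : ℝ := Real.cos (t / 2) / Real.sin (t / 2)

theorem div_pi_le_sin_half {t : ℝ} (h0 : 0 ≤ t) (h1 : t ≤ Real.pi) :
    t / Real.pi ≤ Real.sin (t / 2) := by
  have h := Real.mul_le_sin (x := t / 2) (by linarith) (by linarith)
  calc t / Real.pi = 2 / Real.pi * (t / 2) := by ring
    _ ≤ _ := h

theorem sin_half_pos {t : ℝ} (h0 : 0 < t) (h1 : t ≤ Real.pi) : 0 < Real.sin (t / 2) :=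
  Real.sin_pos_of_pos_of_lt_pi (by linarith) (by linarith [Real.pi_pos])

theorem abs_cotHalf_le {t : ℝ} (h0 : 0 < t) (h1 : t ≤ Real.pi) : |cotHalf t| ≤ Real.pi / t := by
  have hs := sin_half_pos h0 h1
  have hp := Real.pi_pos
  rw [cotHalf, abs_div, abs_of_pos hs, div_le_div_iff₀ hs h0]
  have h := div_pi_le_sin_half h0.le h1
  rw [div_le_iff₀ hp] at h
  nlinarith [Real.abs_cos_le_one (t / 2)]

theorem abs_deriv_cotHalf_le {t : ℝ} (h0 : 0 < t) (h1 : t ≤ Real.pi) :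
    |-(1 / (2 * Real.sin (t / 2) ^ 2))| ≤ Real.pi ^ 2 / 2 * t ^ (-2 : ℝ) := by
  have hs := sin_half_pos h0 h1
  have hp := Real.pi_pos
  have h := div_pi_le_sin_half h0.le h1
  have h2 : (t / Real.pi) ^ 2 ≤ Real.sin (t / 2) ^ 2 := by gcongr
  rw [abs_neg, abs_of_pos (by positivity), Real.rpow_neg h0.le,
    show (2 : ℝ) = ((2 : ℕ) : ℝ) by norm_num, Real.rpow_natCast]
  calc 1 / (((2 : ℕ) : ℝ) * Real.sin (t / 2) ^ 2) ≤ 1 / (((2 : ℕ) : ℝ) * (t / Real.pi) ^ 2) := by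
        gcongr
    _ = _ := by field_simp

theorem hasDerivAt_cotHalf {t : ℝ} (h : Real.sin (t / 2) ≠ 0) :
    HasDerivAt cotHalf (-(1 / (2 * Real.sin (t / 2) ^ 2))) t := by
  have hd : HasDerivAt (fun t : ℝ => t / 2) (1 / 2) t := (hasDerivAt_id t).div_const 2
  refine ((hd.cos).fun_div hd.sin h).congr_deriv ?_
  have := Real.sin_sq_add_cos_sq (t / 2)
  field_simp
  linarith

theorem cotHalf_neg (t : ℝ) : cotHalf (-t) = -cotHalf t := by
  simp [cotHalf, neg_div, div_neg]

theorem continuousOn_cotHalf : ContinuousOn cotHalf (Set.Ioc 0 Real.pi) := fun _ ht =>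
  (hasDerivAt_cotHalf (sin_half_pos ht.1 ht.2).ne').continuousAt.continuousWithinAt

/-- No point is excluded: where the sine or cosine of `t / 2` vanishes, division by zero makes both
kernels `0`. -/
theorem tanIntegrand_eq_smul {𝕜 : Type*} [RCLike 𝕜] (φ : ℝ → 𝕜) (α t : ℝ) :
    tanIntegrand φ α t = cotHalf t • φ (α - t) := by
  rw [tanIntegrand, Real.tan_eq_sin_div_cos, cotHalf, RCLike.real_smul_eq_coe_mul, div_eq_mul_inv,
    ← RCLike.ofReal_inv, inv_div, mul_comm]

theorem HolderWith.norm_sub_le {𝕜 : Type*} [RCLike 𝕜] {C γ : ℝ≥0} {φ : ℝ → 𝕜}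
    (hφ : HolderWith C γ φ) (s t : ℝ) : ‖φ s - φ t‖ ≤ C * |s - t| ^ (γ : ℝ) := by
  simpa [dist_eq_norm] using hφ.dist_le s t

theorem holderWith_of_norm_sub_le {𝕜 : Type*} [RCLike 𝕜] {C γ : ℝ≥0} {φ : ℝ → 𝕜}
    (hφ : ∀ s t : ℝ, ‖φ s - φ t‖ ≤ C * |s - t| ^ (γ : ℝ)) : HolderWith C γ φ := by
  intro s t
  have h := hφ s t
  rw [edist_nndist, edist_nndist, ← ENNReal.coe_rpow_of_nonneg _ γ.coe_nonneg, ← ENNReal.coe_mul,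
    ENNReal.coe_le_coe, ← NNReal.coe_le_coe]
  simpa [dist_eq_norm] using h

/-! ### Central differences and their primitives -/

/-- The odd part `φ (x - t) - φ (x + t)` of a function about `x`. -/
def centralDiff {𝕜 : Type*} [RCLike 𝕜] (φ : ℝ → 𝕜) (x t : ℝ) : 𝕜 := φ (x - t) - φ (x + t)

/-- The primitive in `t` of `centralDiff φ x t`. -/
noncomputable def centralPrimitive {𝕜 : Type*} [RCLike 𝕜] (φ : ℝ → 𝕜) (x t : ℝ) : 𝕜 :=
  ∫ s in (0 : ℝ)..t, centralDiff φ x s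

section

variable {𝕜 : Type*} [RCLike 𝕜] {C γ : ℝ≥0} {φ : ℝ → 𝕜}

theorem continuous_centralDiff (hφ : Continuous φ) (x : ℝ) : Continuous (centralDiff φ x) := by
  unfold centralDiff; fun_prop

theorem two_mul_rpow_le {γ : ℝ≥0} (hγ1 : γ < 1) {t : ℝ} (ht : 0 ≤ t) :
    (2 * t) ^ (γ : ℝ) ≤ 2 * t ^ (γ : ℝ) := by
  rw [Real.mul_rpow (by norm_num) ht]
  gcongr
  exact Real.rpow_le_self_of_one_le (by norm_num) (by exact_mod_cast hγ1.le)

theorem norm_centralDiff_le (hγ1 : γ < 1) (hφ : HolderWith C γ φ) (x : ℝ) {t : ℝ} (ht : 0 ≤ t) :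
    ‖centralDiff φ x t‖ ≤ 2 * C * t ^ (γ : ℝ) := by
  have h := hφ.norm_sub_le (x - t) (x + t)
  rw [show x - t - (x + t) = -(2 * t) by ring, abs_neg, abs_of_nonneg (by positivity)] at h
  have h2 := mul_le_mul_of_nonneg_left (two_mul_rpow_le hγ1 ht) C.coe_nonneg
  unfold centralDiff
  linarith

theorem hasDerivAt_centralPrimitive (hφ : Continuous φ) (x t : ℝ) :
    HasDerivAt (centralPrimitive φ x) (centralDiff φ x t) t :=
  ((continuous_centralDiff hφ x).integral_hasStrictDerivAt 0 t).hasDerivAt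

theorem norm_centralPrimitive_le (hγ1 : γ < 1) (hφ : HolderWith C γ φ) (x : ℝ) {t : ℝ}
    (ht : 0 ≤ t) : ‖centralPrimitive φ x t‖ ≤ 2 * C * t ^ (γ : ℝ) * t := by
  have := intervalIntegral.norm_integral_le_of_norm_le_const (f := centralDiff φ x) (a := 0)
    (b := t) (C := 2 * C * t ^ (γ : ℝ)) (fun s hs => by
      rw [Set.uIoc_of_le ht] at hs
      refine (norm_centralDiff_le hγ1 hφ x hs.1.le).trans ?_
      have := hs.1.le
      have := hs.2
      gcongr)
  rwa [sub_zero, abs_of_nonneg ht] at this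

/-- If `Φ` is a primitive of `φ`, the integral equals `2 Φ(x) - Φ(x - t) - Φ(x + t)`, so it is
differentiable in `x` although `φ` need not be. -/
theorem hasDerivAt_centralPrimitive_left (hφ : Continuous φ) (x t : ℝ) :
    HasDerivAt (fun x => centralPrimitive φ x t) (2 * φ x - φ (x - t) - φ (x + t)) x := by
  have hi : ∀ a b : ℝ, IntervalIntegrable φ MeasureTheory.volume a b :=
    fun a b => hφ.intervalIntegrable a b
  have hd : ∀ y, HasDerivAt (fun u => ∫ s in (0 : ℝ)..u, φ s) (φ y) y := fun y =>
    (hφ.integral_hasStrictDerivAt 0 y).hasDerivAt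
  have heq : (fun x => centralPrimitive φ x t) = fun x =>
      ((∫ s in (0 : ℝ)..x, φ s) - ∫ s in (0 : ℝ)..(x - t), φ s) -
        ((∫ s in (0 : ℝ)..(x + t), φ s) - ∫ s in (0 : ℝ)..x, φ s) := by
    funext x
    unfold centralPrimitive centralDiff
    rw [intervalIntegral.integral_sub (Continuous.intervalIntegrable (by fun_prop) _ _)
      (Continuous.intervalIntegrable (by fun_prop) _ _),
      intervalIntegral.integral_comp_sub_left (fun s => φ s),
      intervalIntegral.integral_comp_add_left (fun s => φ s),
      intervalIntegral.integral_interval_sub_left (hi _ _) (hi _ _),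
      intervalIntegral.integral_interval_sub_left (hi _ _) (hi _ _), sub_zero, add_zero]
  rw [heq]
  refine (((hd x).sub ((hd (x - t)).comp_sub_const x t)).sub
    (((hd (x + t)).comp_add_const x t).sub (hd x))).congr_deriv ?_
  ring

/-- Mean value inequality: the derivative in the base point is a second difference of `φ` with step
`t`, hence at most `2 C t^γ`. -/
theorem norm_centralPrimitive_sub_le (hγ0 : 0 < γ) (hφ : HolderWith C γ φ) (x y : ℝ) {t : ℝ}
    (ht : 0 ≤ t) :
    ‖centralPrimitive φ x t - centralPrimitive φ y t‖ ≤ 2 * C * t ^ (γ : ℝ) * |x - y| := by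
  refine Convex.norm_image_sub_le_of_norm_hasDerivWithin_le (s := Set.univ)
    (f := fun x => centralPrimitive φ x t)
    (fun z _ => (hasDerivAt_centralPrimitive_left (hφ.continuous hγ0) z t).hasDerivWithinAt)
    (fun z _ => ?_) convex_univ (Set.mem_univ _) (Set.mem_univ _)
  have h1 := hφ.norm_sub_le z (z - t)
  have h2 := hφ.norm_sub_le z (z + t)
  rw [show z - (z - t) = t by ring, abs_of_nonneg ht] at h1
  rw [show z - (z + t) = -t by ring, abs_neg, abs_of_nonneg ht] at h2
  rw [show 2 * φ z - φ (z - t) - φ (z + t) = (φ z - φ (z - t)) + (φ z - φ (z + t)) by ring]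
  linarith [norm_add_le (φ z - φ (z - t)) (φ z - φ (z + t))]

/-! ### Existence of the principal value of the Hilbert transform -/

/-- The truncated integrals of the Hilbert transform, folded to positive `t`. -/
theorem hilbert_trunc (hφ : Continuous φ) (α : ℝ) {ε : ℝ} (hε : ε ∈ Set.Ioo 0 (Real.pi / 2)) :
    IntervalIntegrable (tanIntegrand φ α) MeasureTheory.volume (-Real.pi + ε) (-ε) ∧
    IntervalIntegrable (tanIntegrand φ α) MeasureTheory.volume ε (Real.pi - ε) ∧
    truncIntegral (tanIntegrand φ α) ε =
      ∫ t in ε..(Real.pi - ε), cotHalf t • centralDiff φ α t := by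
  obtain ⟨h0, h1⟩ := hε
  have hle : ε ≤ Real.pi - ε := by linarith
  have hc : ContinuousOn cotHalf (Set.uIcc ε (Real.pi - ε)) := by
    rw [Set.uIcc_of_le hle]
    exact continuousOn_cotHalf.mono fun t ht => ⟨h0.trans_le ht.1, by linarith [ht.2]⟩
  have hp : IntervalIntegrable (tanIntegrand φ α) MeasureTheory.volume ε (Real.pi - ε) := by
    simp_rw [funext (tanIntegrand_eq_smul φ α)]
    exact (hc.smul (by fun_prop)).intervalIntegrable
  have hneg : ∀ t, tanIntegrand φ α (-t) = -(cotHalf t • φ (α + t)) := fun t => by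
    rw [tanIntegrand_eq_smul, cotHalf_neg, neg_smul, sub_neg_eq_add]
  have hn : IntervalIntegrable (fun t => tanIntegrand φ α (-t)) MeasureTheory.volume
      ε (Real.pi - ε) := by
    simp_rw [funext hneg]
    exact ((hc.smul (by fun_prop)).neg).intervalIntegrable
  refine ⟨?_, hp, ?_⟩
  · rw [IntervalIntegrable.iff_comp_neg, neg_neg, show -(-Real.pi + ε) = Real.pi - ε by ring]
    exact hn.symm
  · rw [truncIntegral, show -Real.pi + ε = -(Real.pi - ε) by ring,
      ← intervalIntegral.integral_comp_neg, ← intervalIntegral.integral_add hn hp]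
    refine intervalIntegral.integral_congr fun t _ => ?_
    simp only [hneg, tanIntegrand_eq_smul, centralDiff, smul_sub]
    ring

/-- Folding cancels the singularity at `0`: the integrand is dominated by a multiple of `t^(γ-1)`,
integrable because `γ > 0`. -/
theorem intervalIntegrable_cotHalf_smul (hγ0 : 0 < γ) (hγ1 : γ < 1) (hφ : HolderWith C γ φ)
    (x : ℝ) : IntervalIntegrable (fun t => cotHalf t • centralDiff φ x t) MeasureTheory.volume
      0 Real.pi := by
  have hb : IntervalIntegrable (fun t : ℝ => Real.pi * (2 * C) * t ^ ((γ : ℝ) - 1))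
      MeasureTheory.volume 0 Real.pi :=
    (intervalIntegral.intervalIntegrable_rpow' (by
      have : (0 : ℝ) < γ := hγ0
      linarith)).const_mul _
  refine hb.mono_fun' ?_ ?_
  · rw [Set.uIoc_of_le Real.pi_pos.le]
    exact (continuousOn_cotHalf.smul
      (continuous_centralDiff (hφ.continuous hγ0) x).continuousOn).aestronglyMeasurable
        measurableSet_Ioc
  · rw [Set.uIoc_of_le Real.pi_pos.le]
    filter_upwards [MeasureTheory.self_mem_ae_restrict measurableSet_Ioc] with t ht
    rw [norm_smul, Real.norm_eq_abs]
    have h := mul_le_mul (abs_cotHalf_le ht.1 ht.2) (norm_centralDiff_le hγ1 hφ x ht.1.le)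
      (norm_nonneg _) (div_nonneg Real.pi_pos.le ht.1.le)
    refine h.trans_eq ?_
    rw [Real.rpow_sub_one ht.1.ne']
    ring

theorem tendsto_truncIntegral_tanIntegrand (hγ0 : 0 < γ) (hγ1 : γ < 1) (hφ : HolderWith C γ φ)
    (α : ℝ) : Filter.Tendsto (truncIntegral (tanIntegrand φ α)) (𝓝[>] (0 : ℝ))
      (𝓝 (∫ t in (0 : ℝ)..Real.pi, cotHalf t • centralDiff φ α t)) := by
  have hi := intervalIntegrable_cotHalf_smul hγ0 hγ1 hφ α
  have hp := Real.pi_pos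
  have hcont := intervalIntegral.continuousOn_primitive_interval' hi
    (Set.left_mem_uIcc (a := (0 : ℝ)) (b := Real.pi))
  rw [Set.uIcc_of_le hp.le] at hcont
  have hmem : ∀ᶠ ε : ℝ in 𝓝[>] (0 : ℝ), ε ∈ Set.Ioo 0 (Real.pi / 2) :=
    Ioo_mem_nhdsGT (by positivity)
  have ht : Filter.Tendsto (fun ε : ℝ => ε) (𝓝[>] (0 : ℝ)) (𝓝 0) :=
    tendsto_nhdsWithin_of_tendsto_nhds Filter.tendsto_id
  have h1 := (hcont 0 ⟨le_rfl, hp.le⟩).tendsto.comp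
    (tendsto_nhdsWithin_iff.2 ⟨ht, hmem.mono fun ε h => ⟨h.1.le, by linarith [h.2]⟩⟩)
  have h2 := (hcont Real.pi ⟨hp.le, le_rfl⟩).tendsto.comp
    (tendsto_nhdsWithin_iff.2 ⟨by simpa using ht.const_sub Real.pi,
      hmem.mono fun ε h => ⟨by linarith [h.2], by linarith [h.1]⟩⟩)
  have h3 := h2.sub h1
  simp only [intervalIntegral.integral_same, sub_zero] at h3
  refine h3.congr' (hmem.mono fun ε h => ?_)
  rw [(hilbert_trunc (hφ.continuous hγ0) α h).2.2]
  refine intervalIntegral.integral_interval_sub_left (hi.mono_set ?_) (hi.mono_set ?_) <;>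
    refine Set.uIcc_subset_uIcc Set.left_mem_uIcc ?_ <;> rw [Set.uIcc_of_le hp.le] <;>
    constructor <;> linarith [h.1, h.2]

theorem hasPrincipalValue_tanIntegrand (hγ0 : 0 < γ) (hγ1 : γ < 1) (hφ : HolderWith C γ φ)
    (α : ℝ) : HasPrincipalValue (tanIntegrand φ α)
      (∫ t in (0 : ℝ)..Real.pi, cotHalf t • centralDiff φ α t) :=
  ⟨fun _ hε => ⟨(hilbert_trunc (hφ.continuous hγ0) α hε).1,
    (hilbert_trunc (hφ.continuous hγ0) α hε).2.1⟩,
    tendsto_truncIntegral_tanIntegrand hγ0 hγ1 hφ α⟩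

end

/-! ### Privalov's theorem: boundedness of the Hilbert transform -/

section

variable {𝕜 : Type*} [RCLike 𝕜] {C γ : ℝ≥0} {φ : ℝ → 𝕜}

theorem norm_integral_le_of_le_rpow_sub_one (hγ0 : 0 < γ) {f : ℝ → 𝕜} {a b h K : ℝ} (ha : 0 < a)
    (hab : a ≤ b) (hbh : b ≤ h) (hK : 0 ≤ K)
    (hf : ∀ t ∈ Set.Ioc a b, ‖f t‖ ≤ K * t ^ ((γ : ℝ) - 1)) :
    ‖∫ t in a..b, f t‖ ≤ K * (h ^ (γ : ℝ) / γ) := by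
  have hg : (0 : ℝ) < γ := hγ0
  have h1 := intervalIntegral.norm_integral_le_of_norm_le hab (f := f)
    (Filter.Eventually.of_forall hf)
    ((intervalIntegral.intervalIntegrable_rpow' (by linarith)).const_mul K)
  rw [intervalIntegral.integral_const_mul, integral_rpow (Or.inl (by linarith)),
    sub_add_cancel] at h1
  refine h1.trans ?_
  have h2 : b ^ (γ : ℝ) ≤ h ^ (γ : ℝ) := Real.rpow_le_rpow (by linarith) hbh hg.le
  have h3 : (0 : ℝ) ≤ a ^ (γ : ℝ) := Real.rpow_nonneg ha.le _
  gcongr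
  linarith

theorem norm_integral_le_of_le_rpow_sub_two (hγ1 : γ < 1) {f : ℝ → 𝕜} {a b h K : ℝ} (hh : 0 < h)
    (hha : h ≤ a) (hab : a ≤ b) (hK : 0 ≤ K)
    (hf : ∀ t ∈ Set.Ioc a b, ‖f t‖ ≤ K * (h * t ^ ((γ : ℝ) - 2))) :
    ‖∫ t in a..b, f t‖ ≤ K * (h ^ (γ : ℝ) / (1 - γ)) := by
  have hg : (0 : ℝ) < 1 - γ := sub_pos.2 (by exact_mod_cast hγ1)
  have ha : 0 < a := hh.trans_le hha
  have h0 : (0 : ℝ) ∉ Set.uIcc a b := by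
    rw [Set.uIcc_of_le hab]; exact fun h => absurd h.1 (not_le.2 ha)
  have h1 := intervalIntegral.norm_integral_le_of_norm_le hab (f := f)
    (Filter.Eventually.of_forall hf)
    (((intervalIntegral.intervalIntegrable_rpow (μ := MeasureTheory.volume)
      (Or.inr h0)).const_mul h).const_mul K)
  rw [intervalIntegral.integral_const_mul, intervalIntegral.integral_const_mul,
    integral_rpow (Or.inr ⟨by linarith, h0⟩)] at h1
  refine h1.trans ?_
  have h2 : a ^ ((γ : ℝ) - 1) ≤ h ^ ((γ : ℝ) - 1) :=
    Real.rpow_le_rpow_of_nonpos hh hha (by linarith)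
  have h3 : (0 : ℝ) ≤ b ^ ((γ : ℝ) - 1) := Real.rpow_nonneg (by linarith) _
  rw [show (γ : ℝ) - 2 + 1 = -(1 - γ) by ring, div_neg, ← neg_div, neg_sub, ← mul_div_assoc]
  rw [neg_sub (1 : ℝ)]
  gcongr
  calc h * (a ^ ((γ : ℝ) - 1) - b ^ ((γ : ℝ) - 1)) ≤ h * h ^ ((γ : ℝ) - 1) := by gcongr; linarith
    _ = h ^ (γ : ℝ) := by rw [Real.rpow_sub_one hh.ne']; field_simp

/-- A function dominated by `min (t ^ (γ - 1)) (h * t ^ (γ - 2))` has integrals of size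
`h ^ γ`. -/
theorem norm_integral_le_of_le_min (hγ0 : 0 < γ) (hγ1 : γ < 1) {f : ℝ → 𝕜} {a b h K : ℝ}
    (ha : 0 < a) (hab : a ≤ b) (hh : 0 < h) (hK : 0 ≤ K)
    (hfi : IntervalIntegrable f MeasureTheory.volume a b)
    (hf1 : ∀ t ∈ Set.Ioc a b, ‖f t‖ ≤ K * t ^ ((γ : ℝ) - 1))
    (hf2 : ∀ t ∈ Set.Ioc a b, ‖f t‖ ≤ K * (h * t ^ ((γ : ℝ) - 2))) :
    ‖∫ t in a..b, f t‖ ≤ K * (1 / γ + 1 / (1 - γ)) * h ^ (γ : ℝ) := by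
  have hg0 : (0 : ℝ) < γ := hγ0
  have hg1 : (0 : ℝ) < 1 - γ := sub_pos.2 (by exact_mod_cast hγ1)
  have e : K * (1 / γ + 1 / (1 - γ)) * h ^ (γ : ℝ) =
      K * (h ^ (γ : ℝ) / γ) + K * (h ^ (γ : ℝ) / (1 - γ)) := by ring
  have p1 : 0 ≤ K * (h ^ (γ : ℝ) / γ) := by positivity
  have p2 : 0 ≤ K * (h ^ (γ : ℝ) / (1 - γ)) := by positivity
  rw [e]
  -- The crossover point `h` may lie to the right of, to the left of, or inside `[a, b]`; only the
  -- last case needs a split.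
  rcases le_total b h with hbh | hhb
  · linarith [norm_integral_le_of_le_rpow_sub_one hγ0 ha hab hbh hK hf1]
  rcases le_total h a with hha | hah
  · linarith [norm_integral_le_of_le_rpow_sub_two hγ1 hh hha hab hK hf2]
  have hs : h ∈ Set.uIcc a b := by rw [Set.uIcc_of_le hab]; exact ⟨hah, hhb⟩
  rw [← intervalIntegral.integral_add_adjacent_intervals
    (hfi.mono_set (Set.uIcc_subset_uIcc Set.left_mem_uIcc hs))
    (hfi.mono_set (Set.uIcc_subset_uIcc hs Set.right_mem_uIcc))]
  exact (norm_add_le _ _).trans (add_le_add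
    (norm_integral_le_of_le_rpow_sub_one hγ0 ha hah le_rfl hK
      fun t ht => hf1 t ⟨ht.1, ht.2.trans hhb⟩)
    (norm_integral_le_of_le_rpow_sub_two hγ1 hh le_rfl hhb hK
      fun t ht => hf2 t ⟨hah.trans_lt ht.1, ht.2⟩))

theorem integral_cotHalf_smul_by_parts (hφ : Continuous φ) (x : ℝ) {a b : ℝ} (ha : 0 < a)
    (hab : a ≤ b) (hb : b ≤ Real.pi) :
    IntervalIntegrable (fun t => (-(1 / (2 * Real.sin (t / 2) ^ 2))) • centralPrimitive φ x t)
      MeasureTheory.volume a b ∧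
    ∫ t in a..b, cotHalf t • centralDiff φ x t =
      cotHalf b • centralPrimitive φ x b - cotHalf a • centralPrimitive φ x a -
        ∫ t in a..b, (-(1 / (2 * Real.sin (t / 2) ^ 2))) • centralPrimitive φ x t := by
  have hs : ∀ t ∈ Set.uIcc a b, Real.sin (t / 2) ≠ 0 := fun t ht => by
    rw [Set.uIcc_of_le hab] at ht
    exact (sin_half_pos (ha.trans_le ht.1) (ht.2.trans hb)).ne'
  have hw : ContinuousOn (fun t => -(1 / (2 * Real.sin (t / 2) ^ 2))) (Set.uIcc a b) :=
    (ContinuousOn.div (by fun_prop) (by fun_prop) fun t ht =>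
      mul_ne_zero two_ne_zero (pow_ne_zero 2 (hs t ht))).neg
  have hG : ContinuousOn (centralPrimitive φ x) (Set.uIcc a b) := fun t _ =>
    (hasDerivAt_centralPrimitive hφ x t).continuousAt.continuousWithinAt
  exact ⟨(hw.smul hG).intervalIntegrable,
    intervalIntegral.integral_smul_deriv_eq_deriv_smul
      (fun t ht => hasDerivAt_cotHalf (hs t ht)) (fun t _ => hasDerivAt_centralPrimitive hφ x t)
      hw.intervalIntegrable ((continuous_centralDiff hφ x).intervalIntegrable _ _)⟩

theorem norm_centralPrimitive_sub_le' (hγ1 : γ < 1) (hφ : HolderWith C γ φ) (x y : ℝ) {t : ℝ}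
    (ht : 0 ≤ t) :
    ‖centralPrimitive φ x t - centralPrimitive φ y t‖ ≤ 4 * C * t ^ (γ : ℝ) * t := by
  linarith [norm_sub_le (centralPrimitive φ x t) (centralPrimitive φ y t),
    norm_centralPrimitive_le hγ1 hφ x ht, norm_centralPrimitive_le hγ1 hφ y ht]

/-- Controls the boundary terms of the integration by parts, at `t = ε` and `t = π - ε`, by the same
dichotomy between `t` and `|x - y|`. -/
theorem norm_cotHalf_smul_centralPrimitive_sub_le (hγ0 : 0 < γ) (hγ1 : γ < 1)
    (hφ : HolderWith C γ φ) {x y : ℝ} (hxy : x ≠ y) {t : ℝ} (h0 : 0 < t) (h1 : t ≤ Real.pi) :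
    ‖cotHalf t • (centralPrimitive φ x t - centralPrimitive φ y t)‖ ≤
      4 * Real.pi * C * |x - y| ^ (γ : ℝ) := by
  have hh : 0 < |x - y| := abs_pos.2 (sub_ne_zero.2 hxy)
  have hp := Real.pi_pos
  have hg0 : (0 : ℝ) < γ := hγ0
  have hg1 : (γ : ℝ) < 1 := hγ1
  rw [norm_smul, Real.norm_eq_abs]
  rcases le_total t |x - y| with h | h
  · calc _ ≤ Real.pi / t * (4 * C * t ^ (γ : ℝ) * t) :=
          mul_le_mul (abs_cotHalf_le h0 h1) (norm_centralPrimitive_sub_le' hγ1 hφ x y h0.le)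
            (norm_nonneg _) (by positivity)
      _ = 4 * Real.pi * C * t ^ (γ : ℝ) := by field_simp
      _ ≤ _ := by gcongr
  · have h2 : t ^ ((γ : ℝ) - 1) ≤ |x - y| ^ ((γ : ℝ) - 1) :=
      Real.rpow_le_rpow_of_nonpos hh h (by linarith)
    calc _ ≤ Real.pi / t * (2 * C * t ^ (γ : ℝ) * |x - y|) :=
          mul_le_mul (abs_cotHalf_le h0 h1) (norm_centralPrimitive_sub_le hγ0 hφ x y h0.le)
            (norm_nonneg _) (by positivity)
      _ = 2 * Real.pi * C * (t ^ ((γ : ℝ) - 1) * |x - y|) := by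
          rw [Real.rpow_sub_one h0.ne']; ring
      _ ≤ 4 * Real.pi * C * (|x - y| ^ ((γ : ℝ) - 1) * |x - y|) := by gcongr; norm_num
      _ = _ := by rw [Real.rpow_sub_one hh.ne']; field_simp

/-- A bound for the norm of the periodic Hilbert transform on functions of Hölder exponent `γ`. -/
noncomputable def privalovConst (γ : ℝ≥0) : ℝ :=
  8 * Real.pi + 2 * Real.pi ^ 2 * (1 / γ + 1 / (1 - γ))

theorem privalovConst_nonneg (hγ1 : γ < 1) : 0 ≤ privalovConst γ := by
  have hg1 : (0 : ℝ) < 1 - γ := sub_pos.2 (by exact_mod_cast hγ1)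
  have := Real.pi_pos
  unfold privalovConst
  positivity

theorem norm_truncIntegral_sub_le (hγ0 : 0 < γ) (hγ1 : γ < 1) (hφ : HolderWith C γ φ) {x y : ℝ}
    (hxy : x ≠ y) {ε : ℝ} (hε : ε ∈ Set.Ioo 0 (Real.pi / 2)) :
    ‖truncIntegral (tanIntegrand φ x) ε - truncIntegral (tanIntegrand φ y) ε‖ ≤
      privalovConst γ * C * |x - y| ^ (γ : ℝ) := by
  have hc := hφ.continuous hγ0
  have hh : 0 < |x - y| := abs_pos.2 (sub_ne_zero.2 hxy)
  have hp := Real.pi_pos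
  have h0 := hε.1
  have hab : ε ≤ Real.pi - ε := by linarith [hε.2]
  obtain ⟨ix, ex⟩ := integral_cotHalf_smul_by_parts hc x h0 hab (by linarith)
  obtain ⟨iy, ey⟩ := integral_cotHalf_smul_by_parts hc y h0 hab (by linarith)
  -- `K` is the kernel constant `π² / 2` times the `4 C` of the trivial bound; the Lipschitz bound
  -- needs only half of it. The two boundary terms add `4π C` each.
  have hI := norm_integral_le_of_le_min (K := 2 * Real.pi ^ 2 * C) (h := |x - y|) hγ0 hγ1 h0 hab hh
    (by positivity) (ix.sub iy) (fun t ht => ?_) (fun t ht => ?_)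
  · rw [intervalIntegral.integral_sub ix iy] at hI
    have hb := norm_cotHalf_smul_centralPrimitive_sub_le hγ0 hγ1 hφ hxy
      (h0.trans_le hab) (by linarith : Real.pi - ε ≤ Real.pi)
    have ha := norm_cotHalf_smul_centralPrimitive_sub_le hγ0 hγ1 hφ hxy
      h0 (by linarith : ε ≤ Real.pi)
    rw [(hilbert_trunc hc x hε).2.2, (hilbert_trunc hc y hε).2.2, ex, ey]
    rw [smul_sub] at ha hb
    refine le_trans (le_of_eq (congrArg norm ?_)) (((norm_sub_le _ _).trans
      (add_le_add ((norm_sub_le _ _).trans (add_le_add hb ha)) hI)).trans_eq ?_)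
    · abel
    · unfold privalovConst; ring
  all_goals
    have ht0 : 0 < t := h0.trans ht.1
    have htp : t ≤ Real.pi := ht.2.trans (by linarith)
    rw [← smul_sub, norm_smul, Real.norm_eq_abs]
  · refine (mul_le_mul (abs_deriv_cotHalf_le ht0 htp) (norm_centralPrimitive_sub_le' hγ1 hφ x y
      ht0.le) (norm_nonneg _) (by positivity)).trans_eq ?_
    rw [Real.rpow_neg ht0.le, Real.rpow_two, Real.rpow_sub_one ht0.ne']
    field_simp
    ring
  · refine (mul_le_mul (abs_deriv_cotHalf_le ht0 htp) (norm_centralPrimitive_sub_le hγ0 hφ x y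
      ht0.le) (norm_nonneg _) (by positivity)).trans ?_
    rw [Real.rpow_neg ht0.le, Real.rpow_sub ht0, Real.rpow_two]
    have : 0 ≤ Real.pi ^ 2 * C * (|x - y| * (t ^ (γ : ℝ) / t ^ 2)) := by positivity
    calc _ = Real.pi ^ 2 * C * (|x - y| * (t ^ (γ : ℝ) / t ^ 2)) := by ring
      _ ≤ _ := by linarith

theorem norm_hilbertTransform_sub_le (hγ0 : 0 < γ) (hγ1 : γ < 1) (hφ : HolderWith C γ φ)
    (x y : ℝ) : ‖hilbertTransform φ x - hilbertTransform φ y‖ ≤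
      privalovConst γ * C * |x - y| ^ (γ : ℝ) := by
  have hp := Real.pi_gt_three
  have hK := privalovConst_nonneg hγ1
  rcases eq_or_ne x y with rfl | hxy
  · rw [sub_self, norm_zero]; positivity
  have hx := hasPrincipalValue_tanIntegrand hγ0 hγ1 hφ x
  have hy := hasPrincipalValue_tanIntegrand hγ0 hγ1 hφ y
  have hle := le_of_tendsto (hx.2.sub hy.2).norm (Filter.eventually_of_mem
    (Ioo_mem_nhdsGT (by positivity : (0 : ℝ) < Real.pi / 2)) fun ε hε =>
      norm_truncIntegral_sub_le hγ0 hγ1 hφ hxy hε)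
  rw [hilbertTransform, hilbertTransform, hx.principalValue_eq, hy.principalValue_eq, ← mul_sub,
    norm_mul, RCLike.norm_ofReal]
  -- Only finiteness of the norm matters, so the prefactor is discarded.
  have h1 : |1 / (2 * Real.pi)| ≤ 1 := by
    rw [abs_of_pos (by positivity), div_le_one (by positivity)]; linarith
  exact (mul_le_of_le_one_left (norm_nonneg _) h1).trans hle

theorem periodic_hilbertTransform (hφ : Function.Periodic φ (2 * Real.pi)) :
    Function.Periodic (hilbertTransform φ) (2 * Real.pi) := fun α => by
  have : tanIntegrand φ (α + 2 * Real.pi) = tanIntegrand φ α := by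
    funext t
    rw [tanIntegrand, tanIntegrand, add_sub_right_comm, hφ]
  rw [hilbertTransform, hilbertTransform, this]

theorem holderWith_hilbertTransform (hγ0 : 0 < γ) (hγ1 : γ < 1) (hφ : HolderWith C γ φ) :
    HolderWith ((privalovConst γ).toNNReal * C) γ (hilbertTransform φ) :=
  holderWith_of_norm_sub_le fun x y => by
    rw [NNReal.coe_mul, Real.coe_toNNReal _ (privalovConst_nonneg hγ1)]
    exact norm_hilbertTransform_sub_le hγ0 hγ1 hφ x y

theorem eHolderNorm_hilbertTransform_le (hγ0 : 0 < γ) (hγ1 : γ < 1) (hφ : MemHolder γ φ) :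
    eHolderNorm γ (hilbertTransform φ) ≤ (privalovConst γ).toNNReal * eHolderNorm γ φ := by
  rw [← hφ.coe_nnHolderNorm_eq_eHolderNorm, ← ENNReal.coe_mul]
  exact (holderWith_hilbertTransform hγ0 hγ1 hφ.holderWith).eHolderNorm_le

theorem hilbertNorm_lt_top (hγ0 : 0 < γ) (hγ1 : γ < 1) : hilbertNorm 𝕜 γ < ⊤ :=
  (show hilbertNorm 𝕜 γ ≤ (privalovConst γ).toNNReal from
    sInf_le fun _ hφ => eHolderNorm_hilbertTransform_le hγ0 hγ1 hφ.2).trans_lt ENNReal.coe_lt_top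

/-- The infimum defining the norm is itself admissible: divide by the semi-norm of `φ`. When that is
zero, Privalov's bound makes the left side zero. -/
theorem eHolderNorm_hilbertTransform_le_hilbertNorm_mul (hγ0 : 0 < γ) (hγ1 : γ < 1)
    (hφ : φ ∈ holderPeriodic 𝕜 γ) :
    eHolderNorm γ (hilbertTransform φ) ≤ hilbertNorm 𝕜 γ * eHolderNorm γ φ := by
  have hne : eHolderNorm γ φ ≠ ⊤ := eHolderNorm_ne_top.2 hφ.2
  rcases eq_or_ne (eHolderNorm γ φ) 0 with h0 | h0
  · simpa [h0] using eHolderNorm_hilbertTransform_le hγ0 hγ1 hφ.2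
  · rw [← ENNReal.div_le_iff h0 hne]
    exact le_sInf fun M hM => (ENNReal.div_le_iff h0 hne).2 (hM φ hφ)

end

/-! ### From the cotangent to the cosecant -/

section

variable {𝕜 : Type*} [RCLike 𝕜] {C γ : ℝ≥0} {φ : ℝ → 𝕜}

theorem norm_hilbertTransform_sub_le_hilbertNorm (hγ0 : 0 < γ) (hγ1 : γ < 1)
    (hφ : φ ∈ holderPeriodic 𝕜 γ) (x y : ℝ) :
    ‖hilbertTransform φ x - hilbertTransform φ y‖ ≤
      (hilbertNorm 𝕜 γ).toReal * nnHolderNorm γ φ * |x - y| ^ (γ : ℝ) := by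
  have hH : MemHolder γ (hilbertTransform φ) :=
    (holderWith_hilbertTransform hγ0 hγ1 hφ.2.holderWith).memHolder
  have h := eHolderNorm_hilbertTransform_le_hilbertNorm_mul hγ0 hγ1 hφ
  rw [← hH.coe_nnHolderNorm_eq_eHolderNorm, ← hφ.2.coe_nnHolderNorm_eq_eHolderNorm,
    ← ENNReal.coe_toNNReal (hilbertNorm_lt_top hγ0 hγ1).ne, ← ENNReal.coe_mul,
    ENNReal.coe_le_coe, ← NNReal.coe_le_coe, NNReal.coe_mul] at h
  exact (hH.holderWith.norm_sub_le x y).trans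
    (mul_le_mul_of_nonneg_right h (Real.rpow_nonneg (abs_nonneg _) _))

theorem cotHalf_sub_pi (t : ℝ) : cotHalf (t - Real.pi) = -(Real.sin (t / 2) / Real.cos (t / 2)) := by
  rw [cotHalf, sub_div, Real.cos_sub_pi_div_two, Real.sin_sub_pi_div_two, div_neg]

theorem cotHalf_add_pi (t : ℝ) : cotHalf (t + Real.pi) = -(Real.sin (t / 2) / Real.cos (t / 2)) := by
  rw [cotHalf, add_div, Real.cos_add_pi_div_two, Real.sin_add_pi_div_two, neg_div]

/-- This is `1 / sin t = (cot (t/2) + tan (t/2)) / 2`, with `tan` in the form produced by a shift by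
`π`. At zeros of `sin t` every quotient is `0`. -/
theorem inv_sin_eq (t : ℝ) : (Real.sin t)⁻¹ =
    1 / 2 * (cotHalf t - -(Real.sin (t / 2) / Real.cos (t / 2))) := by
  have h2 : Real.sin t = 2 * Real.sin (t / 2) * Real.cos (t / 2) := by
    rw [← Real.sin_two_mul]; congr 1; ring
  rw [h2, cotHalf]
  by_cases hs : Real.sin (t / 2) = 0
  · simp [hs]
  by_cases hc : Real.cos (t / 2) = 0
  · simp [hc]
  field_simp
  linarith [Real.sin_sq_add_cos_sq (t / 2)]

theorem sinIntegrand_eq_sub_pi (φ : ℝ → 𝕜) (α t : ℝ) : sinIntegrand φ α t =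
    (1 / 2 : ℝ) • (tanIntegrand φ α t - tanIntegrand φ (α - Real.pi) (t - Real.pi)) := by
  rw [tanIntegrand_eq_smul, tanIntegrand_eq_smul, sub_sub_sub_cancel_right, ← sub_smul, smul_smul,
    cotHalf_sub_pi, ← inv_sin_eq, sinIntegrand, RCLike.real_smul_eq_coe_mul, RCLike.ofReal_inv,
    div_eq_inv_mul]

/-- Used on the negative half, where `t + π` stays in the truncated domain. Here the argument of `φ`
moves by a full period, whereas the shift by `-π` leaves it unchanged. -/
theorem sinIntegrand_eq_add_pi (hφ : Function.Periodic φ (2 * Real.pi)) (α t : ℝ) :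
    sinIntegrand φ α t =
      (1 / 2 : ℝ) • (tanIntegrand φ α t - tanIntegrand φ (α - Real.pi) (t + Real.pi)) := by
  rw [tanIntegrand_eq_smul, tanIntegrand_eq_smul,
    show α - Real.pi - (t + Real.pi) = α - t - 2 * Real.pi by ring, hφ.sub_eq, ← sub_smul,
    smul_smul, cotHalf_add_pi, ← inv_sin_eq, sinIntegrand, RCLike.real_smul_eq_coe_mul,
    RCLike.ofReal_inv, div_eq_inv_mul]

/-- The cosecant kernel is half the difference of the cotangent kernel and its translate by `π`,
which interchanges the two halves of the truncated interval. -/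
theorem sinIntegrand_trunc (hc : Continuous φ) (hφ : Function.Periodic φ (2 * Real.pi)) (α : ℝ)
    {ε : ℝ} (hε : ε ∈ Set.Ioo 0 (Real.pi / 2)) :
    IntervalIntegrable (sinIntegrand φ α) MeasureTheory.volume (-Real.pi + ε) (-ε) ∧
    IntervalIntegrable (sinIntegrand φ α) MeasureTheory.volume ε (Real.pi - ε) ∧
    truncIntegral (sinIntegrand φ α) ε = (1 / 2 : ℝ) •
      (truncIntegral (tanIntegrand φ α) ε - truncIntegral (tanIntegrand φ (α - Real.pi)) ε) := by
  obtain ⟨n1, p1, -⟩ := hilbert_trunc hc α hε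
  obtain ⟨n2, p2, -⟩ := hilbert_trunc hc (α - Real.pi) hε
  have n2' := n2.comp_sub_right Real.pi
  have p2' := p2.comp_add_right Real.pi
  rw [show -Real.pi + ε + Real.pi = ε by ring, show -ε + Real.pi = Real.pi - ε by ring] at n2'
  rw [show ε - Real.pi = -Real.pi + ε by ring, show Real.pi - ε - Real.pi = -ε by ring] at p2'
  refine ⟨?_, ?_, ?_⟩
  · rw [funext (sinIntegrand_eq_add_pi hφ α)]
    exact (n1.sub p2').smul (1 / 2 : ℝ)
  · rw [funext (sinIntegrand_eq_sub_pi φ α)]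
    exact (p1.sub n2').smul (1 / 2 : ℝ)
  · unfold truncIntegral
    rw [intervalIntegral.integral_congr fun t _ => sinIntegrand_eq_add_pi hφ α t,
      intervalIntegral.integral_congr fun t _ => sinIntegrand_eq_sub_pi φ α t,
      intervalIntegral.integral_smul, intervalIntegral.integral_smul,
      intervalIntegral.integral_sub n1 p2', intervalIntegral.integral_sub p1 n2',
      intervalIntegral.integral_comp_sub_right (fun t => tanIntegrand φ (α - Real.pi) t),
      intervalIntegral.integral_comp_add_right (fun t => tanIntegrand φ (α - Real.pi) t),
      show ε - Real.pi = -Real.pi + ε by ring, show Real.pi - ε - Real.pi = -ε by ring,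
      show -Real.pi + ε + Real.pi = ε by ring, show -ε + Real.pi = Real.pi - ε by ring,
      ← smul_add]
    congr 1
    abel

theorem HasPrincipalValue.sinIntegrand (hc : Continuous φ)
    (hφ : Function.Periodic φ (2 * Real.pi)) {α : ℝ} {I J : 𝕜}
    (hI : HasPrincipalValue (tanIntegrand φ α) I)
    (hJ : HasPrincipalValue (tanIntegrand φ (α - Real.pi)) J) :
    HasPrincipalValue (sinIntegrand φ α) ((1 / 2 : ℝ) • (I - J)) :=
  ⟨fun _ hε => ⟨(sinIntegrand_trunc hc hφ α hε).1, (sinIntegrand_trunc hc hφ α hε).2.1⟩,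
    ((hI.2.sub hJ.2).const_smul (1 / 2 : ℝ)).congr' (Filter.eventually_of_mem
      (Ioo_mem_nhdsGT (half_pos Real.pi_pos)) fun _ hε => (sinIntegrand_trunc hc hφ α hε).2.2.symm)⟩

theorem opK1_eq_hilbertTransform_sub (hc : Continuous φ)
    (hφ : Function.Periodic φ (2 * Real.pi)) {α : ℝ} {I J : 𝕜}
    (hI : HasPrincipalValue (tanIntegrand φ α) I)
    (hJ : HasPrincipalValue (tanIntegrand φ (α - Real.pi)) J) :
    opK1 φ α = hilbertTransform φ α - hilbertTransform φ (α - Real.pi) := by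
  rw [opK1, hilbertTransform, hilbertTransform, hI.principalValue_eq, hJ.principalValue_eq,
    (hI.sinIntegrand hc hφ hJ).principalValue_eq, RCLike.real_smul_eq_coe_mul, ← mul_assoc,
    ← RCLike.ofReal_mul, ← mul_sub]
  congr 2
  ring

end

theorem mainTheorem6 {𝕜 : Type*} [RCLike 𝕜] (γ : ℝ≥0) (hγ0 : 0 < γ) (hγ1 : γ < 1) :
    -- the Hilbert transform is a well-defined bounded operator on `Λ_γ`, so `c_γ` is finite
    ((∀ φ ∈ holderPeriodic 𝕜 γ,
        (∀ α : ℝ, ∃ I : 𝕜, HasPrincipalValue (tanIntegrand φ α) I) ∧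
        hilbertTransform φ ∈ holderPeriodic 𝕜 γ) ∧
      hilbertNorm 𝕜 γ < ⊤) ∧
    -- for even `φ` the integral defining `𝒦₁ φ(α)` exists and obeys the bound
    ∀ φ ∈ holderPeriodic 𝕜 γ, Function.Even φ → ∀ α : ℝ,
      (∃ I : 𝕜, HasPrincipalValue (sinIntegrand φ α) I) ∧
      ‖opK1 φ α‖ ≤ constC 𝕜 γ * (nnHolderNorm γ φ : ℝ) := by
  have hpv : ∀ φ ∈ holderPeriodic 𝕜 γ, ∀ α : ℝ, ∃ I : 𝕜, HasPrincipalValue (tanIntegrand φ α) I :=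
    fun φ hφ α => ⟨_, hasPrincipalValue_tanIntegrand hγ0 hγ1 hφ.2.holderWith α⟩
  refine ⟨⟨fun φ hφ => ⟨hpv φ hφ, periodic_hilbertTransform hφ.1,
    (holderWith_hilbertTransform hγ0 hγ1 hφ.2.holderWith).memHolder⟩,
    hilbertNorm_lt_top hγ0 hγ1⟩, fun φ hφ _ α => ?_⟩
  have hc : Continuous φ := hφ.2.holderWith.continuous hγ0
  obtain ⟨I, hI⟩ := hpv φ hφ α
  obtain ⟨J, hJ⟩ := hpv φ hφ (α - Real.pi)
  refine ⟨⟨_, hI.sinIntegrand hc hφ.1 hJ⟩, ?_⟩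
  have hp := Real.pi_pos
  -- The Hölder bound for `ℋφ` at two points at distance `π`.
  have h := norm_hilbertTransform_sub_le_hilbertNorm hγ0 hγ1 hφ α (α - Real.pi)
  rw [sub_sub_cancel, abs_of_pos hp, ← opK1_eq_hilbertTransform_sub hc hφ.1 hI hJ] at h
  have h2 : Real.pi ^ (γ : ℝ) ≤ (2 * Real.pi) ^ (γ : ℝ) :=
    Real.rpow_le_rpow hp.le (by linarith) γ.coe_nonneg
  have h3 : 0 ≤ (γ : ℝ)⁻¹ * Real.pi ^ ((γ : ℝ) - 1) := by positivity
  calc ‖opK1 φ α‖ ≤ (hilbertNorm 𝕜 γ).toReal * nnHolderNorm γ φ * Real.pi ^ (γ : ℝ) := h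
    _ ≤ (hilbertNorm 𝕜 γ).toReal * nnHolderNorm γ φ * (2 * Real.pi) ^ (γ : ℝ) := by gcongr
    _ = (hilbertNorm 𝕜 γ).toReal * (2 * Real.pi) ^ (γ : ℝ) * nnHolderNorm γ φ := by ring
    _ ≤ constC 𝕜 γ * nnHolderNorm γ φ := by
        unfold constC
        gcongr
        linarith
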